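/- Let $G$ be an infinite, countable, connected (simple) graph in which all vertices have finite degree, let $v_0\in\mathcal V(G)$, and let $\operatorname{wt}:\mathcal E(G)\to(0,\infty)$. Let $(X_e)_{e\in\mathcal E(G)}$ be independent random variables, $X_e$ being exponential with parameter $\operatorname{wt}(e)$. For a finite path $\eta$ in $G$ put $T(\eta)=\sum_{e\in\eta}X_e$, and for vertices $u,v$ let $T(u,v)$ be the infimum of $T(\eta)$ over all paths $\eta$ from $u$ to $v$. For $t\ge 0$ let $A_t$ be the subgraph of $G$ whose vertices are the $v$ with $T(v_0,v)\le t$ and whose edges are the edges traversed by some path $\eta$ started at $v_0$ with $T(\eta)\le t$. Let $\mathcal F_t$ be the $\sigma$-algebra generated by $(A_s)_{0\le s\le t}$ and by $X_e$ for $e\in\mathcal E(A_t)$, and let $\tau_\infty=\inf\{t\ge 0:\#\mathcal E(A_t)=\infty\}$. Assume that $\tau_\infty<\infty$ almost surely. Let $\tau$ be a stopping time for $(\mathcal F_t)_{t\ge 0}$ with $\tau<\tau_\infty$ almost surely. Let $\Gamma_1,\Gamma_2$ be $\mathcal F_\tau$-measurable random subgraphs of $G$ such that, almost surely, both are infinite,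 they lie at graph distance at least $3$ from one another in $G$, and each of them shares a vertex with $A_\tau$. Then, almost surely, $$\mathbb P\Big(\#\mathcal E(A_{\tau_\infty}\cap\Gamma_1)=\#\mathcal E(A_{\tau_\infty}\cap\Gamma_2)=\infty,\ \#\big(\mathcal E(A_{\tau_\infty})\setminus\mathcal E(\Gamma_1\cup\Gamma_2)\big)<\infty\ \Big|\ \mathcal F_\tau\Big)=0 .$$ -/

import Mathlib

open MeasureTheory ProbabilityTheory
open scoped ENNReal NNReal

namespace FPP

/-! ### First passage percolation for a fixed family of edge passage times -/

section Deterministic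

variable {V : Type*} {G : SimpleGraph V}

/-- The total passage time `T(η) = ∑ x_e` of a path `η`, the sum running over the successive edges
of `η`. The edge times that matter are positive, so truncating at `0` changes nothing. -/
noncomputable def pathTime (x : G.edgeSet → ℝ) {u v : V} (η : G.Walk u v) : ℝ≥0∞ :=
  (η.darts.map fun d => ENNReal.ofReal (x ⟨d.edge, d.edge_mem⟩)).sum

/-- The passage time `T(u, v)`: the infimum of `T(η)` over all paths `η` from `u` to `v`. -/
noncomputable def passageTime (x : G.edgeSet → ℝ) (u v : V) : ℝ≥0∞ :=
  ⨅ η : G.Walk u v, pathTime x η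

theorem pathTime_takeUntil_le [DecidableEq V] (x : G.edgeSet → ℝ) {u v w : V} (η : G.Walk u v)
    (h : w ∈ η.support) : pathTime x (η.takeUntil w h) ≤ pathTime x η :=
  ((η.darts_takeUntil_prefix_darts h).sublist.map _).sum_le_sum (by simp)

/-- The cluster `A_t` started from `v₀`: its vertices are the `v` with `T(v₀, v) ≤ t`, and its edges
are the edges traversed by some path `η` that starts at `v₀` and has `T(η) ≤ t`. -/
def cluster (v₀ : V) (x : G.edgeSet → ℝ) (t : ℝ≥0∞) : G.Subgraph where
  verts := {v | passageTime x v₀ v ≤ t}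
  Adj u v := ∃ (w : V) (η : G.Walk v₀ w), s(u, v) ∈ η.edges ∧ pathTime x η ≤ t
  adj_sub := by
    rintro u v ⟨w, η, he, -⟩
    exact η.adj_of_mem_edges he
  edge_vert := by
    classical
    rintro u v ⟨w, η, he, ht⟩
    exact (iInf_le _ (η.takeUntil u (η.fst_mem_support_of_mem_edges he))).trans
      ((pathTime_takeUntil_le x η _).trans ht)
  symm := ⟨fun u v ⟨w, η, he, ht⟩ => ⟨w, η, by rwa [Sym2.eq_swap], ht⟩⟩

/-- The explosion time `τ_∞ = inf {t ≥ 0 : #ℰ(A_t) = ∞}`, equal to `∞` if no `A_t` with `t < ∞` is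
infinite. -/
noncomputable def explosionTime (v₀ : V) (x : G.edgeSet → ℝ) : ℝ≥0∞ :=
  ⨅ (t : ℝ≥0) (_ : (cluster v₀ x t).edgeSet.Infinite), (t : ℝ≥0∞)

theorem cluster_mono (v₀ : V) (x : G.edgeSet → ℝ) {s t : ℝ≥0∞} (h : s ≤ t) :
    cluster v₀ x s ≤ cluster v₀ x t :=
  ⟨fun _ hv => le_trans hv h, fun _ _ ⟨w, η, he, ht⟩ => ⟨w, η, he, ht.trans h⟩⟩

end Deterministic

/-! ### Random subgraphs and the filtration generated by the clusters -/

section Random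

variable {V : Type*} {G : SimpleGraph V}

/-- The product σ-algebra on subgraphs of `G`, generated by the events that a given vertex, or a
given edge, belongs to the subgraph. -/
instance instMeasurableSpaceSubgraph : MeasurableSpace G.Subgraph :=
  MeasurableSpace.comap (fun H => H.verts) inferInstance ⊔
    MeasurableSpace.comap (fun H => H.edgeSet) inferInstance

variable {Ω : Type*}

/-- The σ-algebra `ℱ_t` generated by the random subgraphs `A_s`, `0 ≤ s ≤ t`, and by the passage
times `X_e` of the edges `e` of `A_t` (that is, by the variables equal to `X_e` if `e ∈ ℰ(A_t)` and
to `0` otherwise). -/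
noncomputable abbrev sigmaAlgebra (v₀ : V) (X : G.edgeSet → Ω → ℝ) (t : ℝ≥0) : MeasurableSpace Ω :=
  (⨆ s : ℝ≥0, ⨆ _ : s ≤ t,
    MeasurableSpace.comap (fun ω => cluster v₀ (X · ω) s) inferInstance) ⊔
  (⨆ e : G.edgeSet, MeasurableSpace.comap
    (Set.indicator {ω | (e : Sym2 V) ∈ (cluster v₀ (X · ω) t).edgeSet} (X e)) inferInstance)

theorem measurable_subgraph_iff {m : MeasurableSpace Ω} {H : Ω → G.Subgraph} :
    Measurable H ↔ (∀ v, MeasurableSet {ω | v ∈ (H ω).verts}) ∧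
      ∀ e, MeasurableSet {ω | e ∈ (H ω).edgeSet} := by
  have h1 : Measurable H ↔ Measurable (fun ω => (H ω).verts) ∧
      Measurable (fun ω => (H ω).edgeSet) := by
    simp only [measurable_iff_comap_le, instMeasurableSpaceSubgraph, MeasurableSpace.comap_sup,
      MeasurableSpace.comap_comp, sup_le_iff]
    rfl
  rw [h1, measurable_set_iff, measurable_set_iff]
  simp only [measurableSet_setOfPred]

theorem measurable_pathTime {m : MeasurableSpace Ω} {X : G.edgeSet → Ω → ℝ}
    (hX : ∀ e, Measurable (X e)) {u v : V} (η : G.Walk u v) :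
    Measurable fun ω => pathTime (X · ω) η := by
  unfold pathTime
  induction η.darts with
  | nil => simp
  | cons d l ih =>
    simp only [List.map_cons, List.sum_cons]
    exact (hX _).ennreal_ofReal.add ih

theorem countable_walk [Countable V] (u v : V) : Countable (G.Walk u v) :=
  Function.Injective.countable (f := fun p : G.Walk u v => p.support)
    fun _ _ h => SimpleGraph.Walk.ext_support h

theorem measurable_passageTime [Countable V] {m : MeasurableSpace Ω} {X : G.edgeSet → Ω → ℝ}
    (hX : ∀ e, Measurable (X e)) (u v : V) :
    Measurable fun ω => passageTime (X · ω) u v := by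
  have := countable_walk (G := G) u v
  exact Measurable.iInf fun η => measurable_pathTime hX η

theorem measurable_cluster [Countable V] {m : MeasurableSpace Ω} (v₀ : V) {X : G.edgeSet → Ω → ℝ}
    (hX : ∀ e, Measurable (X e)) (t : ℝ≥0∞) :
    Measurable fun ω => cluster v₀ (X · ω) t := by
  refine measurable_subgraph_iff.2 ⟨fun v => ?_, fun e => ?_⟩
  · exact measurableSet_le (measurable_passageTime hX v₀ v) measurable_const
  · induction e with
    | h u v =>
      have : {ω | s(u, v) ∈ (cluster v₀ (X · ω) t).edgeSet} =
          ⋃ w : V, ⋃ η : G.Walk v₀ w, {ω | s(u, v) ∈ η.edges ∧ pathTime (X · ω) η ≤ t} := by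
        ext ω
        simp [cluster]
      rw [this]
      refine MeasurableSet.iUnion fun w => ?_
      have := countable_walk (G := G) v₀ w
      refine MeasurableSet.iUnion fun η => ?_
      exact (MeasurableSet.const _).inter
        (measurableSet_le (measurable_pathTime hX η) measurable_const)

/-- The filtration `(ℱ_t)_{t ≥ 0}` of the clusters. -/
noncomputable def filtration [Countable V] {m : MeasurableSpace Ω} (v₀ : V) (X : G.edgeSet → Ω → ℝ)
    (hX : ∀ e, Measurable (X e)) : Filtration ℝ≥0 m where
  seq := sigmaAlgebra v₀ X
  mono' := by
    intro s t hst
    refine sup_le ?_ (iSup_le fun e => ?_)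
    · exact le_sup_of_le_left (iSup₂_le fun r hr => le_iSup₂_of_le r (hr.trans hst) le_rfl)
    · have hs : MeasurableSet[sigmaAlgebra v₀ X t]
          {ω | (e : Sym2 V) ∈ (cluster v₀ (X · ω) s).edgeSet} := by
        have : Measurable[sigmaAlgebra v₀ X t] fun ω => cluster v₀ (X · ω) (s : ℝ≥0∞) :=
          measurable_iff_comap_le.2 (le_sup_of_le_left (le_iSup₂_of_le s hst le_rfl))
        exact (measurable_subgraph_iff.1 this).2 e
      have ht : Measurable[sigmaAlgebra v₀ X t]
          (Set.indicator {ω | (e : Sym2 V) ∈ (cluster v₀ (X · ω) t).edgeSet} (X e)) :=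
        measurable_iff_comap_le.2 (le_sup_of_le_right (le_iSup_of_le e le_rfl))
      have key : Set.indicator {ω | (e : Sym2 V) ∈ (cluster v₀ (X · ω) s).edgeSet} (X e) =
          Set.indicator {ω | (e : Sym2 V) ∈ (cluster v₀ (X · ω) s).edgeSet}
            (Set.indicator {ω | (e : Sym2 V) ∈ (cluster v₀ (X · ω) t).edgeSet} (X e)) := by
        rw [Set.indicator_indicator]
        congr 1
        refine (Set.inter_eq_left.2 fun ω hω => ?_).symm
        exact SimpleGraph.Subgraph.edgeSet_mono
          (cluster_mono v₀ _ (ENNReal.coe_le_coe.2 hst)) hω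
      rw [key]
      exact measurable_iff_comap_le.1 (ht.indicator hs)
  le' := by
    intro t
    refine sup_le (iSup₂_le fun s _ => ?_) (iSup_le fun e => ?_)
    · exact measurable_iff_comap_le.1 (measurable_cluster v₀ hX s)
    · exact measurable_iff_comap_le.1
        ((hX e).indicator ((measurable_subgraph_iff.1 (measurable_cluster v₀ hX t)).2 e))

end Random

end FPP

/-! Two explosions at the same instant are a coincidence that an arbitrarily small delay of one of
them destroys, and continuous edge laws give such coincidences probability zero.

On the event, choose rationals `q < q'` strictly between `τ` and `τ_∞`: `Γ₁` and `Γ₂` are known at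
time `q`, and from `q'` until explosion the cluster explores new edges only in `Γ₁ ∪ Γ₂`. Let `B` be
the finite set of unexplored edges of `Γ₂` touching the cluster at time `q'`. Adding `δ > 0` to the
times of the edges in `B` does not alter what is known at time `q`, hence not `Γ₁` and `Γ₂`. As
these share no vertex, growth in `Γ₁` avoids `B`, so explosion is not postponed
(`explosionTime_shift_le`). But every vertex of `Γ₂` reached after `q'` now costs an extra `δ`, so
`Γ₂` cannot explode along with `Γ₁` (`not_shift`).

Hence, for fixed `q`, `q'`, `B`, the bad edge times meet each line in the direction of the indicator
of `B` at most once. By Fubini and absolute continuity of the exponential law they form a null set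
(`infinitePi_expMeasure_eq_zero`). Only countably many triples `(q, q', B)` occur. -/

namespace FPP

/-! ### Deterministic facts on walks and clusters -/

section Walks

variable {V : Type*} {G : SimpleGraph V}

@[simp]
theorem pathTime_nil (x : G.edgeSet → ℝ) (u : V) :
    pathTime x (SimpleGraph.Walk.nil : G.Walk u u) = 0 := by
  simp [pathTime]

theorem pathTime_cons (x : G.edgeSet → ℝ) {u v w : V} (h : G.Adj u v) (p : G.Walk v w) :
    pathTime x (.cons h p) = ENNReal.ofReal (x ⟨s(u, v), h⟩) + pathTime x p := by
  simp [pathTime, SimpleGraph.Dart.edge]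

theorem pathTime_append (x : G.edgeSet → ℝ) {u v w : V} (p : G.Walk u v) (p' : G.Walk v w) :
    pathTime x (p.append p') = pathTime x p + pathTime x p' := by
  simp [pathTime]

theorem pathTime_mono {x y : G.edgeSet → ℝ} (h : x ≤ y) {u v : V} (p : G.Walk u v) :
    pathTime x p ≤ pathTime y p := by
  induction p with
  | nil => simp
  | cons hadj p ih =>
    rw [pathTime_cons, pathTime_cons]
    exact add_le_add (ENNReal.ofReal_le_ofReal (h _)) ih

theorem pathTime_congr {x y : G.edgeSet → ℝ} {u v : V} (p : G.Walk u v)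
    (h : ∀ e : G.edgeSet, (e : Sym2 V) ∈ p.edges → x e = y e) :
    pathTime x p = pathTime y p := by
  induction p with
  | nil => simp
  | cons hadj p ih =>
    rw [pathTime_cons, pathTime_cons, h _ (by simp), ih fun e he => h e (by simp [he])]

theorem mem_edgeSet_cluster {v₀ : V} {x : G.edgeSet → ℝ} {t : ℝ≥0∞} {e : Sym2 V} :
    e ∈ (cluster v₀ x t).edgeSet ↔
      ∃ (w : V) (η : G.Walk v₀ w), e ∈ η.edges ∧ pathTime x η ≤ t := by
  induction e with
  | h u v => simp [cluster]

theorem edgeSet_cluster_mono (v₀ : V) (x : G.edgeSet → ℝ) {s t : ℝ≥0∞} (h : s ≤ t) :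
    (cluster v₀ x s).edgeSet ⊆ (cluster v₀ x t).edgeSet :=
  SimpleGraph.Subgraph.edgeSet_mono (cluster_mono v₀ x h)

/-- The vertices at the end of a path from `v₀` of passage time at most `t`. -/
def reached (v₀ : V) (x : G.edgeSet → ℝ) (t : ℝ≥0∞) : Set V :=
  {u | ∃ η : G.Walk v₀ u, pathTime x η ≤ t}

theorem self_mem_reached (v₀ : V) (x : G.edgeSet → ℝ) (t : ℝ≥0∞) : v₀ ∈ reached v₀ x t :=
  ⟨.nil, by simp⟩

theorem mem_reached_of_mem_edge {v₀ : V} {x : G.edgeSet → ℝ} {t : ℝ≥0∞} {e : Sym2 V} {u : V}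
    (he : e ∈ (cluster v₀ x t).edgeSet) (hu : u ∈ e) : u ∈ reached v₀ x t := by
  classical
  obtain ⟨w, η, heη, ht⟩ := mem_edgeSet_cluster.1 he
  exact ⟨η.takeUntil u (SimpleGraph.Walk.mem_support_of_mem_edges heη hu),
    (pathTime_takeUntil_le x η _).trans ht⟩

theorem reached_subset (v₀ : V) (x : G.edgeSet → ℝ) (t : ℝ≥0∞) :
    reached v₀ x t ⊆ {v₀} ∪ ⋃ e ∈ (cluster v₀ x t).edgeSet, {v | v ∈ e} := by
  rintro u ⟨η, ht⟩
  by_cases hu : u = v₀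
  · exact Or.inl hu
  · have hnil : ¬ η.Nil := fun h => hu h.eq.symm
    refine Or.inr (Set.mem_biUnion (mem_edgeSet_cluster.2
      ⟨u, η, η.mk_penultimate_end_mem_edges hnil, ht⟩) ?_)
    simp

theorem finite_setOf_mem (e : Sym2 V) : {v | v ∈ e}.Finite := by
  induction e with
  | h u v =>
    refine (Set.toFinite {u, v}).subset fun w hw => ?_
    simpa using hw

theorem finite_reached {v₀ : V} {x : G.edgeSet → ℝ} {t : ℝ≥0∞}
    (h : (cluster v₀ x t).edgeSet.Finite) : (reached v₀ x t).Finite :=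
  ((Set.finite_singleton _).union (h.biUnion fun e _ => finite_setOf_mem e)).subset
    (reached_subset v₀ x t)

theorem finite_incident (hfin : ∀ v, (G.neighborSet v).Finite) {W : Set V} (hW : W.Finite) :
    {e | e ∈ G.edgeSet ∧ ∃ v ∈ W, v ∈ e}.Finite := by
  refine (hW.biUnion fun v _ => (hfin v).image fun u => s(v, u)).subset ?_
  rintro e ⟨he, v, hv, hve⟩
  obtain ⟨u, rfl⟩ := hve
  exact Set.mem_biUnion hv ⟨u, he, rfl⟩

/-- Stop just before crossing `e`, whose time is positive. Strictness turns walks of time at most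
`τ_∞` into walks of time below `τ_∞`, where the confinement hypothesis applies. -/
theorem exists_walk_pathTime_lt {x : G.edgeSet → ℝ} (hx : ∀ e, 0 < x e) {a w : V}
    (η : G.Walk a w) {e : Sym2 V} (he : e ∈ η.edges) :
    ∃ u ∈ e, ∃ θ : G.Walk a u, pathTime x θ < pathTime x η := by
  induction η with
  | nil => simp at he
  | @cons a b c h p ih =>
    rw [SimpleGraph.Walk.edges_cons, List.mem_cons] at he
    rcases he with rfl | he
    · refine ⟨a, by simp, .nil, ?_⟩
      rw [pathTime_nil, pathTime_cons]
      exact add_pos_of_pos_of_nonneg (ENNReal.ofReal_pos.2 (hx _)) zero_le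
    · obtain ⟨u, hu, θ, hθ⟩ := ih he
      refine ⟨u, hu, .cons h θ, ?_⟩
      rw [pathTime_cons, pathTime_cons]
      exact ENNReal.add_lt_add_left ENNReal.ofReal_ne_top hθ

/-- If infinitely many edges of a set `C` are explored by time `τ`, then infinitely many endpoints
of edges of `C` are reached strictly before time `τ`. -/
theorem infinite_endpoints (hfin : ∀ v, (G.neighborSet v).Finite) {v₀ : V} {x : G.edgeSet → ℝ}
    (hx : ∀ e, 0 < x e) {τ : ℝ≥0∞} {C : Set (Sym2 V)}
    (h : ((cluster v₀ x τ).edgeSet ∩ C).Infinite) :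
    {u | (∃ e ∈ C, u ∈ e) ∧ ∃ η : G.Walk v₀ u, pathTime x η < τ}.Infinite := by
  intro hW
  refine h ((finite_incident hfin hW).subset ?_)
  rintro e ⟨he, heC⟩
  refine ⟨(cluster v₀ x τ).edgeSet_subset he, ?_⟩
  obtain ⟨w, η, heη, ht⟩ := mem_edgeSet_cluster.1 he
  obtain ⟨u, hu, θ, hθ⟩ := exists_walk_pathTime_lt hx η heη
  exact ⟨u, ⟨⟨e, heC, hu⟩, θ, hθ.trans_le ht⟩, hu⟩

/-- Cutting a walk at its last visit to a set of vertices. -/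
theorem exists_last_visit (x : G.edgeSet → ℝ) (W : Set V) {a u : V} (η : G.Walk a u)
    (hu : u ∉ W) :
    (∀ v ∈ η.support, v ∉ W) ∨ ∃ (w b : V) (h : G.Adj w b) (η₁ : G.Walk a w) (η₂ : G.Walk b u),
      w ∈ W ∧ pathTime x η = pathTime x η₁ + pathTime x (.cons h η₂) ∧
      (∀ v ∈ η₂.support, v ∉ W) ∧
      ∀ e ∈ (SimpleGraph.Walk.cons h η₂).edges, e ∈ η.edges := by
  induction η with
  | nil => left; simpa using hu
  | @cons a b c h p ih =>
    rcases ih hu with ih | ⟨w, b', h', η₁, η₂, hw, hT, hs, he⟩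
    · by_cases ha : a ∈ W
      · exact Or.inr ⟨a, b, h, .nil, p, ha, by simp, ih, fun e he => he⟩
      · left
        intro v hv
        rw [SimpleGraph.Walk.support_cons, List.mem_cons] at hv
        rcases hv with rfl | hv
        · exact ha
        · exact ih v hv
    · refine Or.inr ⟨w, b', h', .cons h η₁, η₂, hw, ?_, hs, fun e hee => ?_⟩
      · rw [pathTime_cons, hT, pathTime_cons x h, add_assoc]
      · rw [SimpleGraph.Walk.edges_cons]
        exact List.mem_cons_of_mem _ (he e hee)

/-- Consecutive edges share a vertex, so a walk cannot switch between `K₁` and `K₂`. The claim about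
the starting vertex carries the induction. -/
theorem edges_subset_of_disjoint {K₁ K₂ : Set (Sym2 V)}
    (hK : ∀ e₁ ∈ K₁, ∀ e₂ ∈ K₂, ∀ v, v ∈ e₁ → v ∉ e₂) {a u : V} (p : G.Walk a u)
    (hp : ∀ e ∈ p.edges, e ∈ K₁ ∨ e ∈ K₂) (hu : ∃ e ∈ K₁, u ∈ e) :
    (∀ e ∈ p.edges, e ∈ K₁) ∧ ∃ e ∈ K₁, a ∈ e := by
  induction p with
  | nil => exact ⟨by simp, hu⟩
  | @cons a b c h p ih =>
    obtain ⟨h1, e, he, hbe⟩ := ih (fun e he => hp e (by simp [he])) hu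
    have hab : s(a, b) ∈ K₁ := by
      rcases hp s(a, b) (by simp) with h2 | h2
      · exact h2
      · exact absurd (Sym2.mem_mk_right a b) (hK e he _ h2 b hbe)
    refine ⟨?_, _, hab, Sym2.mem_mk_left a b⟩
    simpa using ⟨hab, h1⟩

/-- If, after time `q` and before time `τ`, the cluster only grows along edges of the disjoint sets
`K₁` and `K₂`, then an endpoint of `K₁` which is reached between these times is reached from a
vertex reached before time `q` along edges of `K₁`. -/
theorem exists_confined_walk {v₀ : V} {x : G.edgeSet → ℝ} {q τ : ℝ≥0∞} {K₁ K₂ : Set (Sym2 V)}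
    (hK : ∀ e₁ ∈ K₁, ∀ e₂ ∈ K₂, ∀ v, v ∈ e₁ → v ∉ e₂)
    (hconf : ∀ (w : V) (η : G.Walk v₀ w), pathTime x η < τ →
      ∀ e ∈ η.edges, e ∈ (cluster v₀ x q).edgeSet ∨ e ∈ K₁ ∨ e ∈ K₂)
    {u : V} (hu : ∃ e ∈ K₁, u ∈ e) (huq : u ∉ reached v₀ x q) (η : G.Walk v₀ u)
    (hη : pathTime x η < τ) :
    ∃ (w b : V) (h : G.Adj w b) (η₁ : G.Walk v₀ w) (η₂ : G.Walk b u),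
      pathTime x η₁ ≤ q ∧
      (∀ e ∈ (SimpleGraph.Walk.cons h η₂).edges, e ∈ K₁ ∧ e ∉ (cluster v₀ x q).edgeSet) ∧
      pathTime x η₁ + pathTime x (.cons h η₂) ≤ pathTime x η := by
  rcases exists_last_visit x (reached v₀ x q) η huq with h | ⟨w, b, h, η₁, η₂, hw, hT, hs, he⟩
  · exact absurd (self_mem_reached v₀ x q) (h v₀ η.start_mem_support)
  -- Endpoints of explored edges are reached, but each edge after the last visit has an unreached
  -- endpoint.
  have hnot : ∀ e ∈ (SimpleGraph.Walk.cons h η₂).edges, e ∉ (cluster v₀ x q).edgeSet := by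
    intro e hee hec
    rw [SimpleGraph.Walk.edges_cons, List.mem_cons] at hee
    rcases hee with rfl | hee
    · exact hs b η₂.start_mem_support (mem_reached_of_mem_edge hec (Sym2.mem_mk_right w b))
    · obtain ⟨v, hv⟩ : ∃ v, v ∈ e := by
        induction e with
        | h a b => exact ⟨a, Sym2.mem_mk_left a b⟩
      exact hs v (SimpleGraph.Walk.mem_support_of_mem_edges hee hv)
        (mem_reached_of_mem_edge hec hv)
  have hK₁ := (edges_subset_of_disjoint hK (.cons h η₂) (fun e hee =>
    (hconf u η hη e (he e hee)).resolve_left (hnot e hee)) hu).1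
  rcases le_total (pathTime x η₁) q with hq | hq
  -- If the initial piece is slow, a walk witnessing that `w` is reached by time `q` replaces it.
  · exact ⟨w, b, h, η₁, η₂, hq, fun e hee => ⟨hK₁ e hee, hnot e hee⟩, hT.ge⟩
  · obtain ⟨η₁', hq'⟩ := hw
    refine ⟨w, b, h, η₁', η₂, hq', fun e hee => ⟨hK₁ e hee, hnot e hee⟩, ?_⟩
    rw [hT]
    gcongr
    exact hq'.trans hq

theorem explosionTime_le {v₀ : V} {x : G.edgeSet → ℝ} {t : ℝ≥0∞} (ht : t ≠ ∞)
    (h : (cluster v₀ x t).edgeSet.Infinite) : explosionTime v₀ x ≤ t := by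
  lift t to ℝ≥0 using ht
  exact iInf₂_le t h

theorem finite_cluster {v₀ : V} {x : G.edgeSet → ℝ} {t : ℝ≥0∞} (ht : t < explosionTime v₀ x) :
    (cluster v₀ x t).edgeSet.Finite := by
  by_contra h
  exact ht.not_ge (explosionTime_le ht.ne_top h)

end Walks

/-! ### Delaying finitely many unexplored edges -/

section Shift

variable {V : Type*} {G : SimpleGraph V}

open Classical in
/-- Increase by `δ` the passage times of the edges in `B`. -/
noncomputable def shift {ι : Type*} (B : Finset ι) (δ : ℝ) (x : ι → ℝ) : ι → ℝ :=
  fun e => if e ∈ B then x e + δ else x e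

theorem le_shift {ι : Type*} (B : Finset ι) {δ : ℝ} (hδ : 0 ≤ δ) (x : ι → ℝ) :
    x ≤ shift B δ x := by
  intro e
  unfold shift
  split_ifs <;> linarith

theorem shift_of_notMem {ι : Type*} {B : Finset ι} {e : ι} (he : e ∉ B) (δ : ℝ) (x : ι → ℝ) :
    shift B δ x e = x e := by
  simp [shift, he]

theorem shift_of_mem {ι : Type*} {B : Finset ι} {e : ι} (he : e ∈ B) (δ : ℝ) (x : ι → ℝ) :
    shift B δ x e = x e + δ := by
  simp [shift, he]

variable {v₀ : V} {x : G.edgeSet → ℝ} {B : Finset G.edgeSet} {q : ℝ≥0∞} {δ : ℝ}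

theorem pathTime_shift_of_le (hB : ∀ e ∈ B, (e : Sym2 V) ∉ (cluster v₀ x q).edgeSet)
    {w : V} (η : G.Walk v₀ w) (hη : pathTime x η ≤ q) :
    pathTime (shift B δ x) η = pathTime x η :=
  pathTime_congr _ fun e he => shift_of_notMem
    (fun heB => hB e heB (mem_edgeSet_cluster.2 ⟨w, η, he, hη⟩)) δ x

theorem edgeSet_cluster_shift (hδ : 0 ≤ δ)
    (hB : ∀ e ∈ B, (e : Sym2 V) ∉ (cluster v₀ x q).edgeSet) {s : ℝ≥0∞} (hs : s ≤ q) :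
    (cluster v₀ (shift B δ x) s).edgeSet = (cluster v₀ x s).edgeSet := by
  ext e
  rw [mem_edgeSet_cluster, mem_edgeSet_cluster]
  constructor
  · rintro ⟨w, η, he, ht⟩
    exact ⟨w, η, he, (pathTime_mono (le_shift B hδ x) η).trans ht⟩
  · rintro ⟨w, η, he, ht⟩
    exact ⟨w, η, he, (pathTime_shift_of_le hB η (ht.trans hs)).trans_le ht⟩

/-- Vertices are defined through an infimum that need not be attained, hence `s < q` here, whereas
`s ≤ q` suffices for edges. -/
theorem cluster_shift (hδ : 0 ≤ δ)
    (hB : ∀ e ∈ B, (e : Sym2 V) ∉ (cluster v₀ x q).edgeSet) {s : ℝ≥0∞} (hs : s < q) :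
    cluster v₀ (shift B δ x) s = cluster v₀ x s := by
  have hE := edgeSet_cluster_shift hδ hB hs.le
  refine SimpleGraph.Subgraph.ext ?_ ?_
  · ext v
    change passageTime _ _ _ ≤ s ↔ passageTime _ _ _ ≤ s
    constructor
    · exact fun h => (iInf_mono fun η => pathTime_mono (le_shift B hδ x) η).trans h
    · intro h
      -- A nearly optimal walk still takes time below `q`, so it avoids `B` and keeps its time.
      refine le_of_forall_gt_imp_ge_of_dense fun r hr => ?_
      obtain ⟨η, hη⟩ := iInf_lt_iff.1 (h.trans_lt (lt_min hs hr))
      rw [lt_min_iff] at hη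
      refine (iInf_le _ η).trans ?_
      rw [pathTime_shift_of_le hB η hη.1.le]
      exact hη.2.le
  · ext a b
    rw [← SimpleGraph.Subgraph.mem_edgeSet, ← SimpleGraph.Subgraph.mem_edgeSet, hE]

end Shift

/-! ### A delay in `K₂` breaks simultaneity -/

section Growth

variable {V : Type*} {G : SimpleGraph V}

/-- The cluster explodes simultaneously inside the disjoint edge sets `K₁` and `K₂`, after time `q`
it only grows along these sets, and `B` consists of the edges of `K₂` at the boundary of the cluster
at time `q`. -/
structure SimultaneousExplosion (v₀ : V) (q : ℝ≥0∞) (B : Finset G.edgeSet) (K₁ K₂ : Set (Sym2 V))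
    (x : G.edgeSet → ℝ) : Prop where
  pos : ∀ e, 0 < x e
  lt_explosionTime : q < explosionTime v₀ x
  explosionTime_lt : explosionTime v₀ x < ∞
  infinite_left : ((cluster v₀ x (explosionTime v₀ x)).edgeSet ∩ K₁).Infinite
  infinite_right : ((cluster v₀ x (explosionTime v₀ x)).edgeSet ∩ K₂).Infinite
  confined : ∀ (w : V) (η : G.Walk v₀ w), pathTime x η < explosionTime v₀ x →
    ∀ e ∈ η.edges, e ∈ (cluster v₀ x q).edgeSet ∨ e ∈ K₁ ∨ e ∈ K₂
  disjoint : ∀ e₁ ∈ K₁, ∀ e₂ ∈ K₂, ∀ v, v ∈ e₁ → v ∉ e₂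
  boundary : ∀ e : G.edgeSet, e ∈ B ↔
    (e : Sym2 V) ∈ K₂ ∧ (e : Sym2 V) ∉ (cluster v₀ x q).edgeSet ∧
      ∃ v ∈ reached v₀ x q, v ∈ (e : Sym2 V)

theorem simultaneousExplosion_iff {v₀ : V} {q : ℝ≥0∞} {B : Finset G.edgeSet} {K₁ K₂ : Set (Sym2 V)}
    {x : G.edgeSet → ℝ} : SimultaneousExplosion v₀ q B K₁ K₂ x ↔
      (∀ e, 0 < x e) ∧ q < explosionTime v₀ x ∧ explosionTime v₀ x < ∞ ∧
      ((cluster v₀ x (explosionTime v₀ x)).edgeSet ∩ K₁).Infinite ∧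
      ((cluster v₀ x (explosionTime v₀ x)).edgeSet ∩ K₂).Infinite ∧
      (∀ (w : V) (η : G.Walk v₀ w), pathTime x η < explosionTime v₀ x →
        ∀ e ∈ η.edges, e ∈ (cluster v₀ x q).edgeSet ∨ e ∈ K₁ ∨ e ∈ K₂) ∧
      (∀ e₁ ∈ K₁, ∀ e₂ ∈ K₂, ∀ v, v ∈ e₁ → v ∉ e₂) ∧
      ∀ e : G.edgeSet, e ∈ B ↔ (e : Sym2 V) ∈ K₂ ∧ (e : Sym2 V) ∉ (cluster v₀ x q).edgeSet ∧
        ∃ v ∈ reached v₀ x q, v ∈ (e : Sym2 V) :=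
  ⟨fun ⟨h₁, h₂, h₃, h₄, h₅, h₆, h₇, h₈⟩ => ⟨h₁, h₂, h₃, h₄, h₅, h₆, h₇, h₈⟩,
    fun ⟨h₁, h₂, h₃, h₄, h₅, h₆, h₇, h₈⟩ => ⟨h₁, h₂, h₃, h₄, h₅, h₆, h₇, h₈⟩⟩

namespace SimultaneousExplosion

variable {v₀ : V} {q : ℝ≥0∞} {B : Finset G.edgeSet} {K₁ K₂ : Set (Sym2 V)} {x : G.edgeSet → ℝ}
  {δ : ℝ}

theorem notMem_cluster (h : SimultaneousExplosion v₀ q B K₁ K₂ x) (e : G.edgeSet) (he : e ∈ B) :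
    (e : Sym2 V) ∉ (cluster v₀ x q).edgeSet :=
  ((h.boundary e).1 he).2.1

/-- The vertices in `K` reached strictly between `q` and the explosion time form an infinite set. -/
theorem infinite_diff (hfin : ∀ v, (G.neighborSet v).Finite)
    (h : SimultaneousExplosion v₀ q B K₁ K₂ x) {K : Set (Sym2 V)}
    (hK : ((cluster v₀ x (explosionTime v₀ x)).edgeSet ∩ K).Infinite) :
    ({u | (∃ e ∈ K, u ∈ e) ∧ ∃ η : G.Walk v₀ u, pathTime x η < explosionTime v₀ x} \
      reached v₀ x q).Infinite :=
  (infinite_endpoints hfin h.pos hK).sdiff (finite_reached (finite_cluster h.lt_explosionTime))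

/-- The infinitely many vertices of `K₁` reached after `q` and before explosion are reached by walks
avoiding `B`, whose times do not change. -/
theorem explosionTime_shift_le (hfin : ∀ v, (G.neighborSet v).Finite)
    (h : SimultaneousExplosion v₀ q B K₁ K₂ x) :
    explosionTime v₀ (shift B δ x) ≤ explosionTime v₀ x := by
  refine explosionTime_le h.explosionTime_lt.ne fun hcl => ?_
  refine h.infinite_diff hfin h.infinite_left ((finite_reached hcl).subset ?_)
  rintro u ⟨⟨hu, η, hη⟩, huq⟩
  obtain ⟨w, b, hwb, η₁, η₂, hq, hK, hle⟩ :=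
    exists_confined_walk h.disjoint h.confined hu huq η hη
  refine ⟨η₁.append (.cons hwb η₂), ?_⟩
  rw [pathTime_append, pathTime_shift_of_le h.notMem_cluster η₁ hq,
    pathTime_congr (x := shift B δ x) (y := x) (.cons hwb η₂) fun e he =>
      shift_of_notMem (fun heB => ?_) δ x]
  · exact hle.trans hη.le
  · obtain ⟨v, hv⟩ : ∃ v, v ∈ (e : Sym2 V) :=
      ⟨_, Sym2.out_fst_mem _⟩
    exact h.disjoint e (hK e he).1 e ((h.boundary e).1 heB).1 v hv hv

/-- Delaying the growth in `K₂` destroys the simultaneous explosion. -/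
theorem not_shift (hfin : ∀ v, (G.neighborSet v).Finite)
    (h : SimultaneousExplosion v₀ q B K₁ K₂ x) (hδ : 0 < δ) :
    ¬ SimultaneousExplosion v₀ q B K₁ K₂ (shift B δ x) := by
  intro h'
  have hτ := h.explosionTime_shift_le (δ := δ) hfin
  have hcl := edgeSet_cluster_shift hδ.le h.notMem_cluster le_rfl
  -- A late walk to `K₂` leaves the reached set through an edge of `B`, so undoing the shift saves
  -- at least `δ`.
  have key : ∀ u ∈ ({u | (∃ e ∈ K₂, u ∈ e) ∧
      ∃ η : G.Walk v₀ u, pathTime (shift B δ x) η < explosionTime v₀ (shift B δ x)} \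
        reached v₀ (shift B δ x) q), ∃ η : G.Walk v₀ u,
      pathTime x η + ENNReal.ofReal δ ≤ explosionTime v₀ x := by
    rintro u ⟨⟨hu, η, hη⟩, huq⟩
    obtain ⟨w, b, hwb, η₁, η₂, hq, hK, hle⟩ :=
      exists_confined_walk (fun e₁ h₁ e₂ h₂ v hv₁ hv₂ => h'.disjoint e₂ h₂ e₁ h₁ v hv₂ hv₁)
        (fun w η hη e he => (h'.confined w η hη e he).imp_right Or.symm) hu huq η hη
    have hB : (⟨s(w, b), hwb⟩ : G.edgeSet) ∈ B :=
      (h'.boundary _).2 ⟨(hK _ (by simp)).1, (hK _ (by simp)).2, w, ⟨η₁, hq⟩,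
        Sym2.mem_mk_left w b⟩
    refine ⟨η₁.append (.cons hwb η₂), le_trans ?_ (hle.trans (hη.le.trans hτ))⟩
    rw [pathTime_append, pathTime_cons, pathTime_cons, shift_of_mem hB,
      ENNReal.ofReal_add (h.pos _).le hδ.le, add_assoc]
    refine add_le_add (pathTime_mono (le_shift B hδ.le x) _) ?_
    rw [add_right_comm]
    gcongr
    exact pathTime_mono (le_shift B hδ.le x) _
  have hinf := h'.infinite_diff hfin h'.infinite_right
  obtain ⟨u, hu⟩ := hinf.nonempty
  obtain ⟨η, hη⟩ := key u hu
  have hδτ : ENNReal.ofReal δ ≤ explosionTime v₀ x := le_add_self.trans hη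
  have hδ' : ENNReal.ofReal δ ≠ 0 := (ENNReal.ofReal_pos.2 hδ).ne'
  have hlt : explosionTime v₀ x - ENNReal.ofReal δ < explosionTime v₀ x :=
    ENNReal.sub_lt_self h.explosionTime_lt.ne
      (fun h0 => hδ' (le_antisymm (h0 ▸ hδτ) zero_le)) hδ'
  -- Infinitely many vertices would be reached by time `τ_∞ - δ` for the original times, before
  -- explosion.
  refine hinf ((finite_reached (finite_cluster hlt)).subset fun u hu => ?_)
  obtain ⟨η, hη⟩ := key u hu
  exact ⟨η, ENNReal.le_sub_of_add_le_right ENNReal.ofReal_ne_top hη⟩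

end SimultaneousExplosion

end Growth

end FPP

namespace FPP

/-! ### Measurability of the explosion events -/

section Measurability

theorem measurable_infinite {Ω β : Type*} [Countable β] [MeasurableSpace Ω] {Z : Ω → Set β}
    (hZ : ∀ b, Measurable fun ω => b ∈ Z ω) : Measurable fun ω => (Z ω).Infinite := by
  have : (fun ω => (Z ω).Infinite) = fun ω => ∀ F : Finset β, ∃ b, b ∉ F ∧ b ∈ Z ω := by
    ext ω
    constructor
    · intro h F
      obtain ⟨b, hb, hbF⟩ := h.exists_notMem_finset F
      exact ⟨b, hbF, hb⟩
    · intro h hfin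
      obtain ⟨b, hb, hbZ⟩ := h hfin.toFinset
      exact hb (hfin.mem_toFinset.2 hbZ)
  rw [this]
  exact Measurable.forall fun F => Measurable.exists fun b => measurable_const.and (hZ b)

variable {V Ω : Type*} {G : SimpleGraph V} [Countable V] [MeasurableSpace Ω]
  {X : G.edgeSet → Ω → ℝ}

theorem measurable_mem_edgeSet_cluster (v₀ : V) (hX : ∀ e, Measurable (X e)) {T : Ω → ℝ≥0∞}
    (hT : Measurable T) (e : Sym2 V) :
    Measurable fun ω => e ∈ (cluster v₀ (X · ω) (T ω)).edgeSet := by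
  simp_rw [mem_edgeSet_cluster]
  refine Measurable.exists fun w => ?_
  have := countable_walk (G := G) v₀ w
  exact Measurable.exists fun η => measurable_const.and
    (measurableSet_setOfPred.1 (measurableSet_le (measurable_pathTime hX η) hT))

theorem measurable_explosionTime (v₀ : V) (hX : ∀ e, Measurable (X e)) :
    Measurable fun ω => explosionTime v₀ (X · ω) := by
  refine measurable_of_Iio fun c => ?_
  have : (fun ω => explosionTime v₀ (X · ω)) ⁻¹' Set.Iio c = {ω | ∃ r : ℚ,
      ((r : ℝ).toNNReal : ℝ≥0∞) < c ∧
        (cluster v₀ (X · ω) ((r : ℝ).toNNReal : ℝ≥0∞)).edgeSet.Infinite} := by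
    ext ω
    simp only [Set.mem_preimage, Set.mem_Iio, Set.mem_ofPred_eq]
    constructor
    · intro h
      obtain ⟨t, ht⟩ := iInf_lt_iff.1 h
      obtain ⟨hinf, htc⟩ := iInf_lt_iff.1 ht
      obtain ⟨r, -, htr, hrc⟩ := ENNReal.lt_iff_exists_rat_btwn.1 htc
      exact ⟨r, hrc, hinf.mono (edgeSet_cluster_mono v₀ _ htr.le)⟩
    · rintro ⟨r, hrc, hinf⟩
      exact (explosionTime_le ENNReal.coe_ne_top hinf).trans_lt hrc
  rw [this, measurableSet_setOfPred]
  exact Measurable.exists fun r => measurable_const.and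
    (measurable_infinite fun e => measurable_mem_edgeSet_cluster v₀ hX measurable_const e)

theorem measurableSet_simultaneousExplosion (v₀ : V) (q : ℝ≥0∞) (B : Finset G.edgeSet)
    {K₁ K₂ : (G.edgeSet → ℝ) → Set (Sym2 V)} (hK₁ : ∀ e, Measurable fun x => e ∈ K₁ x)
    (hK₂ : ∀ e, Measurable fun x => e ∈ K₂ x) :
    MeasurableSet {x | SimultaneousExplosion v₀ q B (K₁ x) (K₂ x) x} := by
  have hX : ∀ e : G.edgeSet, Measurable fun x : G.edgeSet → ℝ => x e := fun e =>
    measurable_pi_apply e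
  have hτ := measurable_explosionTime (X := fun (e : G.edgeSet) (x : G.edgeSet → ℝ) => x e) v₀ hX
  have hc := fun {T : (G.edgeSet → ℝ) → ℝ≥0∞} (hT : Measurable T) (e : Sym2 V) =>
    measurable_mem_edgeSet_cluster (X := fun (e : G.edgeSet) (x : G.edgeSet → ℝ) => x e)
      v₀ hX hT e
  have hp := fun {u v : V} (η : G.Walk u v) =>
    measurable_pathTime (X := fun (e : G.edgeSet) (x : G.edgeSet → ℝ) => x e) hX η
  have hw := fun u v => countable_walk (G := G) u v
  simp_rw [simultaneousExplosion_iff]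
  rw [measurableSet_setOfPred]
  refine .and (.forall fun e => ?_) <| .and ?_ <| .and ?_ <| .and ?_ <| .and ?_ <|
    .and (.forall fun w => .forall fun η => .imp ?_ <| .forall fun e => .imp ?_ <|
      .or (hc measurable_const e) <| .or (hK₁ e) (hK₂ e)) <|
    .and (.forall fun e₁ => .imp (hK₁ e₁) <| .forall fun e₂ => .imp (hK₂ e₂) measurable_const) <|
    .forall fun e => .iff measurable_const <| .and (hK₂ e) <| .and (hc measurable_const e).not <|
      .exists fun v => .and (.exists fun η => ?_) measurable_const
  · exact measurableSet_setOfPred.1 (measurableSet_lt measurable_const (hX e))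
  · exact measurableSet_setOfPred.1 (measurableSet_lt measurable_const hτ)
  · exact measurableSet_setOfPred.1 (measurableSet_lt hτ measurable_const)
  · exact measurable_infinite fun e => (hc hτ e).and (hK₁ e)
  · exact measurable_infinite fun e => (hc hτ e).and (hK₂ e)
  · exact measurableSet_setOfPred.1 (measurableSet_lt (hp η) hτ)
  · exact measurable_const
  · exact measurableSet_setOfPred.1 (measurableSet_le (hp η) measurable_const)

end Measurability

/-! ### Null sets of products of exponential laws -/

section AbsoluteContinuity

open Measure

theorem ae_expMeasure_iff {r : ℝ} (hr : 0 < r) {p : ℝ → Prop} :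
    (∀ᵐ a ∂expMeasure r, p a) ↔ ∀ᵐ a : ℝ, 0 < a → p a := by
  have h0 : ∀ᵐ a : ℝ, a ≠ 0 := by simp [ae_iff]
  unfold expMeasure gammaMeasure gammaPDF
  rw [ae_withDensity_iff (measurable_gammaPDFReal 1 r).ennreal_ofReal]
  constructor <;> intro h <;> filter_upwards [h, h0] with a ha ha0 hap
  · exact ha (ENNReal.ofReal_pos.2 (gammaPDFReal_pos zero_lt_one hr hap)).ne'
  · refine ha (lt_of_le_of_ne (le_of_not_gt fun hneg => hap ?_) ha0.symm)
    exact gammaPDF_of_neg hneg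

/-- The exponential law has the null sets of Lebesgue measure on the positive half-line, and
Lebesgue measure is translation invariant. -/
theorem ae_expMeasure_of_ae_add {r : ℝ} (hr : 0 < r) {δ : ℝ} {p : ℝ → Prop}
    (h : ∀ᵐ a ∂expMeasure r, p (a + δ)) : ∀ᵐ a ∂expMeasure r, δ < a → p a := by
  rw [ae_expMeasure_iff hr] at h ⊢
  have := (measurePreserving_sub_right volume δ).quasiMeasurePreserving.ae h
  filter_upwards [this] with a ha _ hδ
  simpa using ha (sub_pos.2 hδ)

variable {ι : Type*}

theorem measurable_update_uncurry [DecidableEq ι] {E : ι → Type*} [∀ i, MeasurableSpace (E i)]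
    (i : ι) : Measurable fun p : (∀ j, E j) × E i => Function.update p.1 i p.2 := by
  refine measurable_pi_iff.2 fun j => ?_
  by_cases hj : j = i
  · subst hj; simpa using measurable_snd
  · simp only [Function.update_of_ne hj]; fun_prop

open Classical in
-- Resampling one coordinate preserves the product law; this isolates a coordinate for Fubini.
theorem map_update_infinitePi {E : ι → Type*} [∀ i, MeasurableSpace (E i)]
    (m : ∀ i, Measure (E i)) [∀ i, IsProbabilityMeasure (m i)] (i : ι) :
    ((infinitePi m).prod (m i)).map (fun p => Function.update p.1 i p.2) = infinitePi m := by
  have hmeas : Measurable fun p : (∀ j, E j) × E i => Function.update p.1 i p.2 :=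
    measurable_update_uncurry i
  refine eq_infinitePi m fun s t ht => ?_
  rw [map_apply hmeas (MeasurableSet.pi s.countable_toSet fun j _ => ht j)]
  by_cases hi : i ∈ s
  · have : (fun p : (∀ j, E j) × E i => Function.update p.1 i p.2) ⁻¹' Set.pi s t =
        Set.pi (s.erase i : Finset ι) t ×ˢ t i := by
      ext ⟨y, a⟩
      simp only [Set.mem_preimage, Set.mem_pi, Set.mem_prod, Finset.mem_coe, Finset.mem_erase]
      constructor
      · refine fun h => ⟨fun j hj => ?_, ?_⟩
        · simpa [hj.1] using h j hj.2
        · simpa using h i hi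
      · rintro ⟨h1, h2⟩ j hj
        by_cases hji : j = i
        · subst hji; simpa using h2
        · simpa [hji] using h1 j ⟨hji, hj⟩
    rw [this, prod_prod, infinitePi_pi _ fun j _ => ht j, Finset.prod_erase_mul _ _ hi]
  · have : (fun p : (∀ j, E j) × E i => Function.update p.1 i p.2) ⁻¹' Set.pi s t =
        Set.pi s t ×ˢ Set.univ := by
      ext ⟨y, a⟩
      simp only [Set.mem_preimage, Set.mem_pi, Set.mem_prod, Finset.mem_coe, Set.mem_univ,
        and_true]
      refine forall₂_congr fun j hj => ?_
      have hji : j ≠ i := fun h => hi (h ▸ hj)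
      simp [hji]
    rw [this, prod_prod, infinitePi_pi _ fun j _ => ht j, measure_univ, mul_one]

theorem measurable_shift (B : Finset ι) :
    Measurable fun p : ℝ × (ι → ℝ) => shift B p.1 p.2 := by
  refine measurable_pi_iff.2 fun e => ?_
  by_cases he : e ∈ B
  · simp only [shift_of_mem he]; fun_prop
  · simp only [shift_of_notMem he]; fun_prop

theorem shift_shift (B : Finset ι) (δ δ' : ℝ) (x : ι → ℝ) :
    shift B δ' (shift B δ x) = shift B (δ + δ') x := by
  ext e
  by_cases he : e ∈ B
  · simp only [shift_of_mem he]; ring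
  · simp only [shift_of_notMem he]

theorem ae_infinitePi_of_ae_shift_singleton {r : ι → ℝ} (hr : ∀ i, 0 < r i) (i : ι) {δ : ℝ}
    {N : Set (ι → ℝ)} (hN : MeasurableSet N)
    [∀ i, IsProbabilityMeasure (expMeasure (r i))]
    (h : ∀ᵐ x ∂infinitePi (fun i => expMeasure (r i)), shift {i} δ x ∈ N) :
    ∀ᵐ x ∂infinitePi (fun i => expMeasure (r i)), δ < x i → x ∈ N := by
  classical
  have hmeas : Measurable fun p : (ι → ℝ) × ℝ => Function.update p.1 i p.2 :=
    measurable_update_uncurry i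
  have hmap := map_update_infinitePi (fun i => expMeasure (r i)) i
  have hset : MeasurableSet {x : ι → ℝ | δ < x i → x ∈ N} := by
    rw [measurableSet_setOfPred]
    exact (measurableSet_setOfPred.1
      (measurableSet_lt measurable_const (measurable_pi_apply i))).imp
        (measurableSet_setOfPred.1 hN)
  rw [← hmap] at h ⊢
  rw [ae_map_iff hmeas.aemeasurable hset]
  have h1 := ae_ae_of_ae_prod (ae_of_ae_map hmeas.aemeasurable h)
  refine (ae_prod_iff_ae_ae (hmeas hset)).2 ?_
  filter_upwards [h1] with y hy
  have : ∀ᵐ a ∂expMeasure (r i), Function.update y i (a + δ) ∈ N := by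
    filter_upwards [hy] with a ha
    convert ha using 1
    ext j
    by_cases hj : j = i
    · subst hj; simp [shift]
    · simp [shift, hj]
  simpa using ae_expMeasure_of_ae_add (p := fun a => Function.update y i a ∈ N) (hr i) this

theorem ae_infinitePi_of_ae_shift {r : ι → ℝ} (hr : ∀ i, 0 < r i) (B : Finset ι) {δ : ℝ}
    {N : Set (ι → ℝ)} (hN : MeasurableSet N)
    [∀ i, IsProbabilityMeasure (expMeasure (r i))]
    (h : ∀ᵐ x ∂infinitePi (fun i => expMeasure (r i)), shift B δ x ∈ N) :
    ∀ᵐ x ∂infinitePi (fun i => expMeasure (r i)), (∀ i ∈ B, δ < x i) → x ∈ N := by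
  classical
  induction B using Finset.induction_on generalizing N with
  | empty =>
    filter_upwards [h] with x hx _
    have : shift ∅ δ x = x := by ext j; simp [shift]
    rwa [this] at hx
  | insert i B hi ih =>
    have hset : MeasurableSet {x : ι → ℝ | δ < x i → x ∈ N} := by
      rw [measurableSet_setOfPred]
      exact (measurableSet_setOfPred.1
        (measurableSet_lt measurable_const (measurable_pi_apply i))).imp
          (measurableSet_setOfPred.1 hN)
    have hmB : Measurable (shift B δ) := (measurable_shift B).comp measurable_prodMk_left
    have h1 : ∀ᵐ x ∂infinitePi (fun i => expMeasure (r i)), shift {i} δ x ∈ shift B δ ⁻¹' N := by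
      filter_upwards [h] with x hx
      have : shift B δ (shift {i} δ x) = shift (insert i B) δ x := ?_
      · rwa [Set.mem_preimage, this]
      ext j
      by_cases hj : j = i
      · subst hj; simp [shift, hi]
      · simp [shift, hj]
    have h2 := ih (N := {x | δ < x i → x ∈ N}) hset (by
      filter_upwards [ae_infinitePi_of_ae_shift_singleton hr i (hmB hN) h1] with x hx hδ
      rw [shift_of_notMem hi] at hδ
      exact hx hδ)
    filter_upwards [h2] with x hx hδ
    exact hx (fun j hj => hδ j (Finset.mem_insert_of_mem hj)) (hδ i (Finset.mem_insert_self i B))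

/-- A set of positive vectors which meets each line in the direction of the indicator of `B` at
most once is a null set for a product of exponential laws. -/
theorem infinitePi_expMeasure_eq_zero {r : ι → ℝ} (hr : ∀ i, 0 < r i) (B : Finset ι)
    {N : Set (ι → ℝ)} (hN : MeasurableSet N) (hpos : ∀ x ∈ N, ∀ i ∈ B, 0 < x i)
    (hline : ∀ x ∈ N, ∀ δ > 0, shift B δ x ∉ N) :
    infinitePi (fun i => expMeasure (r i)) N = 0 := by
  have (i : ι) : IsProbabilityMeasure (expMeasure (r i)) := isProbabilityMeasure_expMeasure (hr i)
  set ν := infinitePi (fun i => expMeasure (r i))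
  have hsub : ∀ y : ι → ℝ, {δ : ℝ | shift B δ y ∈ N}.Subsingleton := by
    intro y a ha b hb
    by_contra hab
    wlog hlt : a < b generalizing a b
    · exact this hb ha (Ne.symm hab) (lt_of_le_of_ne (not_lt.1 hlt) (Ne.symm hab))
    refine hline _ ha (b - a) (sub_pos.2 hlt) ?_
    rw [shift_shift, add_sub_cancel]
    exact hb
  have hmeas : MeasurableSet {p : ℝ × (ι → ℝ) | shift B p.1 p.2 ∉ N} :=
    (measurable_shift B hN).compl
  -- Fubini: for each `y` at most one `δ` is bad.
  have h1 : ∀ᵐ δ : ℝ, ∀ᵐ y ∂ν, shift B δ y ∉ N := by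
    rw [ae_ae_comm hmeas]
    refine ae_of_all _ fun y => ?_
    rw [ae_iff]
    simpa using (hsub y).measure_zero volume
  -- Arbitrarily small good `δ` exist, and absolute continuity transfers the conclusion from the
  -- shifted point to the point itself wherever its `B`-coordinates exceed `δ`.
  have h2 : ∀ n : ℕ, ∃ δ : ℝ, δ < 1 / (n + 1) ∧ ∀ᵐ y ∂ν, (∀ i ∈ B, δ < y i) → y ∉ N := by
    intro n
    have hpos' : (volume.restrict (Set.Ioo (0 : ℝ) (1 / (n + 1)))) ≠ 0 := by
      rw [Ne, restrict_eq_zero, Real.volume_Ioo, sub_zero, ENNReal.ofReal_eq_zero, not_le]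
      positivity
    have : (ae (volume.restrict (Set.Ioo (0 : ℝ) (1 / (n + 1))))).NeBot := ae_neBot.2 hpos'
    obtain ⟨δ, hδ, hδn⟩ := ((ae_restrict_of_ae (s := Set.Ioo (0 : ℝ) (1 / (n + 1))) h1).and
      (ae_restrict_mem measurableSet_Ioo)).exists
    exact ⟨δ, hδn.2, ae_infinitePi_of_ae_shift hr B hN.compl hδ⟩
  choose δ hδ hδN using h2
  rw [← compl_compl N]
  change ∀ᵐ y ∂ν, y ∉ N
  filter_upwards [ae_all_iff.2 hδN] with y hy hyN
  have hy' := hpos y hyN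
  -- As `B` is finite, its coordinates are bounded away from zero, so some `δ n` lies below them
  -- all.
  obtain ⟨c, hc, hcB⟩ : ∃ c > 0, ∀ i ∈ B, c ≤ y i := by
    rcases B.eq_empty_or_nonempty with rfl | hB
    · exact ⟨1, one_pos, by simp⟩
    · obtain ⟨i, hi, hmin⟩ := B.exists_min_image y hB
      exact ⟨y i, hy' i hi, hmin⟩
  obtain ⟨n, hn⟩ := exists_nat_one_div_lt hc
  exact hy n (fun i hi => ((hδ n).trans hn).trans_le (hcB i hi)) hyN

end AbsoluteContinuity

end FPP

namespace FPP

/-! ### Events of the filtration as sets of edge times -/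

section Filtration

variable {V Ω : Type*} {G : SimpleGraph V}

theorem sigmaAlgebra_eq_comap (v₀ : V) (X : G.edgeSet → Ω → ℝ) (t : ℝ≥0) :
    sigmaAlgebra v₀ X t = (sigmaAlgebra v₀ (fun (e : G.edgeSet) (x : G.edgeSet → ℝ) => x e) t).comap
      (fun ω e => X e ω) := by
  simp only [sigmaAlgebra, MeasurableSpace.comap_sup, MeasurableSpace.comap_iSup,
    MeasurableSpace.comap_comp]
  rfl

/-- Events of the σ-algebra at time `t` do not distinguish between edge times for which the explored
clusters and the passage times of the explored edges agree up to time `t`. -/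
theorem mem_iff_of_measurableSet_sigmaAlgebra {v₀ : V} {t : ℝ≥0} {x y : G.edgeSet → ℝ}
    (hcl : ∀ s : ℝ≥0, s ≤ t → cluster v₀ x s = cluster v₀ y s)
    (hxy : ∀ e : G.edgeSet, (e : Sym2 V) ∈ (cluster v₀ x t).edgeSet → x e = y e)
    {S : Set (G.edgeSet → ℝ)}
    (hS : MeasurableSet[sigmaAlgebra v₀ (fun (e : G.edgeSet) (x : G.edgeSet → ℝ) => x e) t] S) :
    x ∈ S ↔ y ∈ S := by
  -- The sets that do not separate `x` from `y` form a σ-algebra, so only generators need checking.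
  let M : MeasurableSpace (G.edgeSet → ℝ) :=
    { MeasurableSet' := fun S => x ∈ S ↔ y ∈ S
      measurableSet_empty := by simp
      measurableSet_compl := fun S hS => by simp [hS]
      measurableSet_iUnion := fun S hS => by simp [hS] }
  have hle : sigmaAlgebra v₀ (fun (e : G.edgeSet) (x : G.edgeSet → ℝ) => x e) t ≤ M := by
    refine sup_le (iSup₂_le fun s hs => ?_) (iSup_le fun e => ?_)
    · rintro _ ⟨U, -, rfl⟩
      change cluster v₀ x s ∈ U ↔ cluster v₀ y s ∈ U
      rw [hcl s hs]
    · rintro _ ⟨U, -, rfl⟩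
      change Set.indicator _ _ x ∈ U ↔ Set.indicator _ _ y ∈ U
      suffices h : Set.indicator {x : G.edgeSet → ℝ | (e : Sym2 V) ∈ (cluster v₀ x t).edgeSet}
          (fun x => x e) x = Set.indicator {x : G.edgeSet → ℝ |
            (e : Sym2 V) ∈ (cluster v₀ x t).edgeSet} (fun x => x e) y by
        exact iff_of_eq (congrArg (· ∈ U) h)
      classical
      simp only [Set.indicator_apply, Set.mem_ofPred_eq, ← hcl t le_rfl]
      split_ifs with h
      · exact hxy e h
      · rfl
  exact hle S hS

theorem sigmaAlgebra_le [Countable V] (v₀ : V) (t : ℝ≥0) :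
    sigmaAlgebra v₀ (fun (e : G.edgeSet) (x : G.edgeSet → ℝ) => x e) t ≤ MeasurableSpace.pi :=
  (filtration v₀ (fun (e : G.edgeSet) (x : G.edgeSet → ℝ) => x e)
    fun e => measurable_pi_apply e).le t

end Filtration

/-! ### Nullity for fixed times and boundary -/

section Null

variable {V : Type*} {G : SimpleGraph V} [Countable V]

/-- `K₁` and `K₂` depend only on what is seen up to `q`, while the shift affects edges unexplored at
`q' > q`. So both sets are constant along the shift and `not_shift` applies. -/
theorem infinitePi_simultaneousExplosion_eq_zero (hfin : ∀ v, (G.neighborSet v).Finite) (v₀ : V)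
    {wt : G.edgeSet → ℝ} (hwt : ∀ e, 0 < wt e) {q : ℝ≥0} {q' : ℝ≥0∞} (hq : q < q')
    (B : Finset G.edgeSet) {K₁ K₂ : (G.edgeSet → ℝ) → Set (Sym2 V)}
    (hK₁ : ∀ e, MeasurableSet[sigmaAlgebra v₀ (fun (e : G.edgeSet) (x : G.edgeSet → ℝ) => x e) q]
      {x | e ∈ K₁ x})
    (hK₂ : ∀ e, MeasurableSet[sigmaAlgebra v₀ (fun (e : G.edgeSet) (x : G.edgeSet → ℝ) => x e) q]
      {x | e ∈ K₂ x}) :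
    Measure.infinitePi (fun e => expMeasure (wt e))
      {x | SimultaneousExplosion v₀ q' B (K₁ x) (K₂ x) x} = 0 := by
  refine infinitePi_expMeasure_eq_zero hwt B
    (measurableSet_simultaneousExplosion v₀ q' B
      (fun e => measurableSet_setOfPred.1 (sigmaAlgebra_le v₀ q _ (hK₁ e)))
      (fun e => measurableSet_setOfPred.1 (sigmaAlgebra_le v₀ q _ (hK₂ e))))
    (fun x hx e _ => hx.pos e) fun x hx δ hδ hx' => ?_
  have hx : SimultaneousExplosion v₀ q' B (K₁ x) (K₂ x) x := hx
  have hx' : SimultaneousExplosion v₀ q' B (K₁ (shift B δ x)) (K₂ (shift B δ x))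
    (shift B δ x) := hx'
  have hcl : ∀ s : ℝ≥0, s ≤ q → cluster v₀ x s = cluster v₀ (shift B δ x) s := fun s hs =>
    (cluster_shift hδ.le hx.notMem_cluster ((ENNReal.coe_le_coe.2 hs).trans_lt hq)).symm
  have heq : ∀ e : G.edgeSet, (e : Sym2 V) ∈ (cluster v₀ x q).edgeSet → x e = shift B δ x e :=
    fun e he => (shift_of_notMem (fun heB =>
      hx.notMem_cluster e heB (edgeSet_cluster_mono v₀ x hq.le he)) δ x).symm
  have h₁ : K₁ x = K₁ (shift B δ x) := Set.ext fun e =>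
    mem_iff_of_measurableSet_sigmaAlgebra hcl heq (hK₁ e)
  have h₂ : K₂ x = K₂ (shift B δ x) := Set.ext fun e =>
    mem_iff_of_measurableSet_sigmaAlgebra hcl heq (hK₂ e)
  rw [← h₁, ← h₂] at hx'
  exact hx.not_shift hfin hδ hx'

end Null

/-! ### Choice of times and boundary; conclusion -/

section Assembly

variable {V : Type*} {G : SimpleGraph V}

/-- A time before explosion by which the cluster has explored all the edges outside `K₁ ∪ K₂` that it
ever explores before explosion. -/
theorem exists_confining_time {v₀ : V} {x : G.edgeSet → ℝ} {K₁ K₂ : Set (Sym2 V)}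
    (h : ((cluster v₀ x (explosionTime v₀ x)).edgeSet \ (K₁ ∪ K₂)).Finite) {q : ℝ≥0∞}
    (hq : q < explosionTime v₀ x) :
    ∃ t, q ≤ t ∧ t < explosionTime v₀ x ∧
      ∀ (w : V) (η : G.Walk v₀ w), pathTime x η < explosionTime v₀ x →
        ∀ e ∈ η.edges, e ∈ (cluster v₀ x t).edgeSet ∨ e ∈ K₁ ∨ e ∈ K₂ := by
  classical
  set τ := explosionTime v₀ x
  -- Each edge explored before `τ` is explored by some earlier `d e`; only finitely many edges
  -- outside `K₁ ∪ K₂` matter, so a maximum stays below `τ`.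
  have hd : ∀ e : Sym2 V, ∃ t < τ, q ≤ t ∧
      ∀ (w : V) (η : G.Walk v₀ w), pathTime x η < τ → e ∈ η.edges →
        e ∈ (cluster v₀ x t).edgeSet := by
    intro e
    by_cases he : ∃ (w : V) (η : G.Walk v₀ w), pathTime x η < τ ∧ e ∈ η.edges
    · obtain ⟨w, η, hη, he⟩ := he
      exact ⟨max q (pathTime x η), max_lt hq hη, le_max_left _ _, fun _ _ _ _ =>
        mem_edgeSet_cluster.2 ⟨w, η, he, le_max_right _ _⟩⟩
    · exact ⟨q, hq, le_rfl, fun w η hη hee => absurd ⟨w, η, hη, hee⟩ he⟩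
  choose d hdτ hqd hd using hd
  refine ⟨max q (h.toFinset.sup d), le_max_left _ _,
    max_lt hq ((Finset.sup_lt_iff (bot_le.trans_lt hq)).2 fun e _ => hdτ e),
    fun w η hη e he => ?_⟩
  by_cases heK : e ∈ K₁ ∪ K₂
  · exact Or.inr heK
  · refine Or.inl (edgeSet_cluster_mono v₀ x ?_ (hd e w η hη he))
    refine le_max_of_le_right (Finset.le_sup (f := d) (h.mem_toFinset.2 ⟨?_, heK⟩))
    exact mem_edgeSet_cluster.2 ⟨w, η, he, hη.le⟩

theorem exists_boundary (hfin : ∀ v, (G.neighborSet v).Finite) {v₀ : V} {x : G.edgeSet → ℝ}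
    {q : ℝ≥0∞} (hq : q < explosionTime v₀ x) (K : Set (Sym2 V)) :
    ∃ B : Finset G.edgeSet, ∀ e : G.edgeSet, e ∈ B ↔
      (e : Sym2 V) ∈ K ∧ (e : Sym2 V) ∉ (cluster v₀ x q).edgeSet ∧
        ∃ v ∈ reached v₀ x q, v ∈ (e : Sym2 V) := by
  have hfi := (finite_incident hfin (finite_reached (finite_cluster hq))).preimage
    (f := ((↑) : G.edgeSet → Sym2 V)) Subtype.val_injective.injOn
  have : {e : G.edgeSet | (e : Sym2 V) ∈ K ∧ (e : Sym2 V) ∉ (cluster v₀ x q).edgeSet ∧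
      ∃ v ∈ reached v₀ x q, v ∈ (e : Sym2 V)}.Finite :=
    hfi.subset fun e he => ⟨e.2, he.2.2⟩
  exact ⟨this.toFinset, fun e => by simp⟩

theorem notMem_edge_of_dist {H₁ H₂ : G.Subgraph}
    (h : ∀ u ∈ H₁.verts, ∀ v ∈ H₂.verts, 3 ≤ G.dist u v) :
    ∀ e₁ ∈ H₁.edgeSet, ∀ e₂ ∈ H₂.edgeSet, ∀ v, v ∈ e₁ → v ∉ e₂ := by
  intro e₁ h₁ e₂ h₂ v hv₁ hv₂
  have := h v (H₁.mem_verts_of_mem_edge h₁ hv₁) v (H₂.mem_verts_of_mem_edge h₂ hv₂)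
  simp at this

/-- On `τ ≤ q`, information at time `τ` is information at time `q`, hence a function of the edge
times. This replaces the random `Γ` by sets to which the shift argument applies. -/
theorem exists_measurableSet_preimage [Countable V] {Ω : Type*} {m : MeasurableSpace Ω} {v₀ : V}
    {X : G.edgeSet → Ω → ℝ} {hX : ∀ e, Measurable (X e)} {τ : Ω → ℝ≥0∞}
    (hτ : IsStoppingTime (filtration v₀ X hX) τ) {Γ : Ω → G.Subgraph}
    (hΓ : Measurable[hτ.measurableSpace] Γ) (q : ℝ≥0) (e : Sym2 V) :
    ∃ S, MeasurableSet[sigmaAlgebra v₀ (fun (e : G.edgeSet) (x : G.edgeSet → ℝ) => x e) q] S ∧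
      ∀ ω, (X · ω) ∈ S ↔ e ∈ (Γ ω).edgeSet ∧ τ ω ≤ q := by
  have h := (measurable_subgraph_iff.1 hΓ).2 e
  have h2 : MeasurableSet[sigmaAlgebra v₀ X q] ({ω | e ∈ (Γ ω).edgeSet} ∩ {ω | τ ω ≤ q}) := h.2 q
  rw [sigmaAlgebra_eq_comap] at h2
  obtain ⟨S, hS, hpre⟩ := h2
  exact ⟨S, hS, fun ω => Set.ext_iff.1 hpre ω⟩

end Assembly

end FPP

theorem proposition2p5 {V Ω : Type*} [Countable V] [Infinite V]
    (G : SimpleGraph V) (hconn : G.Connected) (hfin : ∀ v, (G.neighborSet v).Finite)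
    (v₀ : V) (wt : G.edgeSet → ℝ) (hwt : ∀ e, 0 < wt e)
    [MeasurableSpace Ω] (μ : Measure Ω) [IsProbabilityMeasure μ]
    (X : G.edgeSet → Ω → ℝ) (hX : ∀ e, Measurable (X e))
    (hlaw : ∀ e, HasLaw (X e) (expMeasure (wt e)) μ) (hindep : iIndepFun X μ)
    (hexpl : ∀ᵐ ω ∂μ, FPP.explosionTime v₀ (X · ω) < ∞)
    (τ : Ω → ℝ≥0∞) (hτ : IsStoppingTime (FPP.filtration v₀ X hX) τ)
    (hτ_lt : ∀ᵐ ω ∂μ, τ ω < FPP.explosionTime v₀ (X · ω))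
    (Γ₁ Γ₂ : Ω → G.Subgraph)
    (hΓ₁ : Measurable[hτ.measurableSpace] Γ₁) (hΓ₂ : Measurable[hτ.measurableSpace] Γ₂)
    (hΓ₁_inf : ∀ᵐ ω ∂μ, (Γ₁ ω).verts.Infinite) (hΓ₂_inf : ∀ᵐ ω ∂μ, (Γ₂ ω).verts.Infinite)
    (hdist : ∀ᵐ ω ∂μ, ∀ u ∈ (Γ₁ ω).verts, ∀ v ∈ (Γ₂ ω).verts, 3 ≤ G.dist u v)
    (hΓ₁_meet : ∀ᵐ ω ∂μ, ((Γ₁ ω).verts ∩ (FPP.cluster v₀ (X · ω) (τ ω)).verts).Nonempty)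
    (hΓ₂_meet : ∀ᵐ ω ∂μ, ((Γ₂ ω).verts ∩ (FPP.cluster v₀ (X · ω) (τ ω)).verts).Nonempty)
    (A : Ω → G.Subgraph)
    (hA : ∀ ω, A ω = FPP.cluster v₀ (X · ω) (FPP.explosionTime v₀ (X · ω)))
    (E : Set Ω)
    (hE : E = {ω | (A ω ⊓ Γ₁ ω).edgeSet.Infinite ∧ (A ω ⊓ Γ₂ ω).edgeSet.Infinite ∧
      ((A ω).edgeSet \ (Γ₁ ω ⊔ Γ₂ ω).edgeSet).Finite}) :
    MeasurableSet E ∧ μ⟦E | hτ.measurableSpace⟧ =ᵐ[μ] 0 := by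
  have hΓ₁m := (FPP.measurable_subgraph_iff.1 (hΓ₁.mono hτ.measurableSpace_le le_rfl)).2
  have hΓ₂m := (FPP.measurable_subgraph_iff.1 (hΓ₂.mono hτ.measurableSpace_le le_rfl)).2
  simp only [measurableSet_setOfPred] at hΓ₁m hΓ₂m
  have hAm := fun e => FPP.measurable_mem_edgeSet_cluster v₀ hX
    (FPP.measurable_explosionTime v₀ hX) e
  simp only [hA, SimpleGraph.Subgraph.edgeSet_inf, SimpleGraph.Subgraph.edgeSet_sup] at hE
  refine ⟨?_, ?_⟩
  · rw [hE, measurableSet_setOfPred]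
    refine .and (FPP.measurable_infinite fun e => (hAm e).and (hΓ₁m e)) <|
      .and (FPP.measurable_infinite fun e => (hAm e).and (hΓ₂m e)) ?_
    simp_rw [← Set.not_infinite]
    exact (FPP.measurable_infinite fun e => (hAm e).and ((hΓ₁m e).or (hΓ₂m e)).not).not
  -- A null event has zero conditional probability given any σ-algebra.
  suffices hnull : ∀ᵐ ω ∂μ, ω ∉ E by
    have h0 : E.indicator (fun _ => (1 : ℝ)) =ᵐ[μ] 0 := by
      filter_upwards [hnull] with ω hω
      simp [hω]
    exact (condExp_congr_ae h0).trans (by rw [condExp_zero])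
  have hmap : μ.map (fun ω e => X e ω) = Measure.infinitePi fun e => expMeasure (wt e) :=
    (hindep.hasLaw_infinitePi hlaw (measurable_pi_iff.2 hX).aemeasurable).map_eq
  choose S₁ hS₁ hS₁' using fun (q : ℚ) => FPP.exists_measurableSet_preimage hτ hΓ₁ (q : ℝ).toNNReal
  choose S₂ hS₂ hS₂' using fun (q : ℚ) => FPP.exists_measurableSet_preimage hτ hΓ₂ (q : ℝ).toNNReal
  have hN : ∀ q q' : ℚ, ((q : ℝ).toNNReal : ℝ≥0∞) < (q' : ℝ).toNNReal → ∀ B : Finset G.edgeSet,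
      ∀ᵐ ω ∂μ, ¬ FPP.SimultaneousExplosion v₀ (q' : ℝ).toNNReal B
        {e | (X · ω) ∈ S₁ q e} {e | (X · ω) ∈ S₂ q e} (X · ω) := by
    intro q q' hq B
    have h := FPP.infinitePi_simultaneousExplosion_eq_zero hfin v₀ hwt hq B
      (K₁ := fun x => {e | x ∈ S₁ q e}) (K₂ := fun x => {e | x ∈ S₂ q e}) (hS₁ q) (hS₂ q)
    rw [← hmap] at h
    have h' : ∀ᵐ x ∂μ.map (fun ω e => X e ω), ¬ FPP.SimultaneousExplosion v₀ (q' : ℝ).toNNReal B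
        {e | x ∈ S₁ q e} {e | x ∈ S₂ q e} x := by
      rw [ae_iff]
      simpa only [not_not] using h
    exact ae_of_ae_map (measurable_pi_iff.2 hX).aemeasurable h'
  have hpos : ∀ᵐ ω ∂μ, ∀ e, 0 < X e ω := by
    refine ae_all_iff.2 fun e => ?_
    refine ae_of_ae_map (p := fun a => 0 < a) (hX e).aemeasurable ?_
    rw [(hlaw e).map_eq, FPP.ae_expMeasure_iff (hwt e)]
    exact ae_of_all _ fun a ha => ha
  have hN' := ae_all_iff.2 fun q => ae_all_iff.2 fun q' => ae_all_iff.2 fun hq =>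
    ae_all_iff.2 fun B => hN q q' hq B
  filter_upwards [hexpl, hτ_lt, hdist, hpos, hN'] with ω hexpl hτ_lt hdist hpos hN' hωE
  rw [hE] at hωE
  obtain ⟨hinf₁, hinf₂, hout⟩ := hωE
  obtain ⟨q, -, hτq, hq⟩ := ENNReal.lt_iff_exists_rat_btwn.1 hτ_lt
  -- Since `τ ω < q`, the deterministic functions of the edge times recover `Γ₁` and `Γ₂` at `ω`.
  have hK₁ : {e | (X · ω) ∈ S₁ q e} = (Γ₁ ω).edgeSet :=
    Set.ext fun e => (hS₁' q e ω).trans (and_iff_left hτq.le)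
  have hK₂ : {e | (X · ω) ∈ S₂ q e} = (Γ₂ ω).edgeSet :=
    Set.ext fun e => (hS₂' q e ω).trans (and_iff_left hτq.le)
  obtain ⟨t, hqt, ht, hconf⟩ := FPP.exists_confining_time hout hq
  obtain ⟨q', -, htq', hq'⟩ := ENNReal.lt_iff_exists_rat_btwn.1 ht
  obtain ⟨B, hB⟩ := FPP.exists_boundary hfin hq' (Γ₂ ω).edgeSet
  refine hN' q q' (hqt.trans_lt htq') B ?_
  rw [hK₁, hK₂]
  exact ⟨hpos, hq', hexpl, hinf₁, hinf₂, fun w η hη e he => (hconf w η hη e he).imp_left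
    fun h => FPP.edgeSet_cluster_mono v₀ _ htq'.le h, FPP.notMem_edge_of_dist hdist, hB⟩
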